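/- For $n\ge 1$ and $k \ge 1$ the Kneser graph $KG(n,k)$ has the $k$-subsets of $\{1,\dots,n\}$ as its vertices, two of them being adjacent if and only if they are disjoint. A vertex cut of a connected graph $G$ is a set $S$ of vertices such that $G-S$ is disconnected; it is a super vertex cut if moreover $G-S$ has no isolated vertex. The super-connectivity $\kappa_1(G)$ is the minimum size of a super vertex cut of $G$. Theorem. Let $n\ge 7$. Then $KG(n,3)$ has a super vertex cut, and its super-connectivity is \[ \kappa_1(KG(n,3))=\begin{cases} 2\left(\binom{n-3}{3}-1\right) & \text{if } 7\le n\le 8,\\[2pt] 2\left(\binom{n-3}{3}-1\right)-\binom{n-6}{3} & \text{if } n\ge 9.\end{cases} \] Moreover, a set $S$ of vertices of $KG(n,3)$ is a super vertex cut of size $\kappa_1(KG(n,3))$ if and only if it is the neighbourhood of an edge, that is, if and only if there is an edge $uv$ of $KG(n,3)$ such that $S=(N(u)\cup N(v))\setminus\{u,v\}$, where $N(x)$ is the set of neighbours of $x$. (This is the case $k=3$ of the Boruzanli–Gauci conjecture: for $n\ge 2k+1$, $\kappa_1(KG(n,k))$ is $2\left(\binom{n-k}{k}-1\right)$ if $2k+1\le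 n<3k$ and $2\left(\binom{n-k}{k}-1\right)-\binom{n-2k}{k}$ if $n\ge 3k$.) -/

import Mathlib

/-- The Kneser graph `KG(n, k)`: the vertices are the `k`-subsets of an `n`-set, and two distinct
vertices are adjacent when they are disjoint. (For `k ≥ 1` disjoint vertices are automatically
distinct.) -/
def kneserGraph (n k : ℕ) : SimpleGraph {s : Finset (Fin n) // s.card = k} where
  Adj s t := s ≠ t ∧ Disjoint s.1 t.1
  symm := ⟨fun _ _ h => ⟨h.1.symm, h.2.symm⟩⟩
  loopless := ⟨fun _ h => h.1 rfl⟩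

namespace SimpleGraph

variable {V : Type*}

/-- A vertex cut of a connected graph `G`: a set of vertices whose deletion makes `G` disconnected.
`¬ Preconnected` says that some two remaining vertices are joined by no walk in `G - S`, so the graph
without vertices does not count as disconnected. -/
def IsVertexCut (G : SimpleGraph V) (S : Finset V) : Prop :=
  G.Connected ∧ ¬ (G.induce ((S : Set V)ᶜ)).Preconnected

/-- A super vertex cut: a vertex cut `S` such that `G - S` has no isolated vertex. -/
def IsSuperVertexCut (G : SimpleGraph V) (S : Finset V) : Prop :=
  G.IsVertexCut S ∧ ∀ v, ∃ w, (G.induce ((S : Set V)ᶜ)).Adj v w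

/-- The super-connectivity `κ₁` of `G`: the minimum size of a super vertex cut
(with the junk value `0` if there is no super vertex cut). -/
noncomputable def superConnectivity (G : SimpleGraph V) : ℕ :=
  sInf {m | ∃ S : Finset V, G.IsSuperVertexCut S ∧ S.card = m}

/-- The neighbourhood of the pair `{u, v}`: the vertices other than `u`, `v` that are adjacent to
`u` or to `v`. -/
def pairNeighborSet (G : SimpleGraph V) (u v : V) : Set V :=
  (G.neighborSet u ∪ G.neighborSet v) \ {u, v}

end SimpleGraph

/-!
Deleting a super vertex cut `S` splits the remaining vertices into two parts without edges between
them, each containing an edge. Read as families of triples, the parts are cross-intersecting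
families `A ∋ U, V` and `B ∋ X, Y` with `U`, `V` disjoint and `X`, `Y` disjoint, so everything
reduces to the sharp bound `|A| + |B| ≤ 9 n - 34` and to the claim that equality forces one of the
families to have only two members.

Replacing elements by others (UV-compression of both families at once) keeps the families
cross-intersecting and does not change their sizes. In this way we first reach
`U ∪ V = X ∪ Y =: C`, and then, for a point `z ∉ C`, we may assume that `z` can be replaced in the
members of `B` by every point of `C`. The links of `z` in `A` and `B` are then cross-intersecting
families of edges of two copies of `K_{3,3}` on the six points of `C`, which together have at most
`9` members; if they have exactly `9`, one link is all of `K_{3,3}` and the other family is a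
disjoint pair. Removing such points `z` one at a time leaves two cross-intersecting families of
triples in the six-element set `C`, which have at most `20` members because complementary triples
cannot lie in different families; hence the bound `20 + 9 (n - 6) = 9 n - 34`.
-/

section CrossIntersectingFamilies

open Finset
open scoped FinsetFamily

variable {α : Type*} {A B E F : Finset (Finset α)}

/-- Two families of finite sets are cross-intersecting if every member of the first meets every
member of the second. In a Kneser graph this says that no edge joins the two families. -/
def CrossIntersecting (A B : Finset (Finset α)) : Prop :=
  ∀ ⦃a⦄, a ∈ A → ∀ ⦃b⦄, b ∈ B → ¬ Disjoint a b

theorem CrossIntersecting.symm (h : CrossIntersecting A B) : CrossIntersecting B A :=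
  fun _ hb _ ha hd => h ha hb hd.symm

theorem CrossIntersecting.mono (h : CrossIntersecting A B) (hE : E ⊆ A) (hF : F ⊆ B) :
    CrossIntersecting E F :=
  fun _ ha _ hb => h (hE ha) (hF hb)

variable [DecidableEq α] {k m : ℕ} {z p : α} {s t U V X Y C G P : Finset α}

theorem compress_singleton_of_notMem (hz : z ∉ s) : UV.compress {p} {z} s = s :=
  if_neg fun h => hz (singleton_subset_iff.1 h.2)

theorem compress_singleton (hz : z ∈ s) (hp : p ∉ s) :
    UV.compress {p} {z} s = insert p (s.erase z) := by
  rw [UV.compress_of_disjoint_of_le (by simpa using hp) (by simpa using hz)]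
  grind

theorem disjoint_compress_singleton (h : Disjoint s t) (hst : z ∉ s ∪ t ∨ p ∉ s ∪ t) :
    Disjoint (UV.compress {p} {z} s) (UV.compress {p} {z} t) := by
  simp only [UV.compress, disjoint_left] at *
  grind

theorem mem_compression_of_notMem (hs : s ∈ A) (hz : z ∉ s) : s ∈ 𝓒 {p} {z} A := by
  simpa only [compress_singleton_of_notMem hz] using
    UV.compress_mem_compression (u := {p}) (v := {z}) hs

theorem CrossIntersecting.not_disjoint_of_notMem (h : CrossIntersecting A B) (hs : s ∈ A)
    (hs' : UV.compress {p} {z} s ∈ A) (ht : t ∈ 𝓒 {p} {z} B) (htB : t ∉ B) : ¬ Disjoint s t := by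
  intro hd
  have hpt : p ∈ t := singleton_subset_iff.1 (UV.le_of_mem_compression_of_notMem ht htB)
  have hzt : z ∉ t := disjoint_singleton_left.1 (UV.disjoint_of_mem_compression_of_notMem ht htB)
  have hb : (t ∪ {z}) \ {p} ∈ B := UV.sup_sdiff_mem_of_mem_compression_of_notMem ht htB
  have hps : p ∉ s := fun hps => disjoint_left.1 hd hps hpt
  have hzs : z ∈ s := by
    have := not_disjoint_iff.1 (h hs hb)
    grind [disjoint_left]
  rw [compress_singleton hzs hps] at hs'
  have := not_disjoint_iff.1 (h hs' hb)
  grind [disjoint_left]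

theorem CrossIntersecting.compression (h : CrossIntersecting A B) (p z : α) :
    CrossIntersecting (𝓒 {p} {z} A) (𝓒 {p} {z} B) := by
  intro s hs t ht
  by_cases hsA : s ∈ A <;> by_cases htB : t ∈ B
  · exact h hsA htB
  · have hs' : UV.compress {p} {z} s ∈ A := by simpa [hsA] using UV.mem_compression.1 hs
    exact h.not_disjoint_of_notMem hsA hs' ht htB
  · have ht' : UV.compress {p} {z} t ∈ B := by simpa [htB] using UV.mem_compression.1 ht
    exact fun hd => h.symm.not_disjoint_of_notMem htB ht' hs hsA hd.symm
  · have hps := singleton_subset_iff.1 (UV.le_of_mem_compression_of_notMem hs hsA)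
    have hpt := singleton_subset_iff.1 (UV.le_of_mem_compression_of_notMem ht htB)
    exact not_disjoint_iff.2 ⟨p, hps, hpt⟩

/-- A family of `k`-subsets of `G` with two marked members that are disjoint: the form taken by a
part of a Kneser graph that contains an edge. -/
structure IsPairedFamily (k : ℕ) (G : Finset α) (A : Finset (Finset α)) (U V : Finset α) :
    Prop where
  subset_powersetCard : A ⊆ powersetCard k G
  left_mem : U ∈ A
  right_mem : V ∈ A
  disjoint : Disjoint U V

theorem compression_subset_powersetCard (hA : A ⊆ powersetCard k G) (hp : p ∈ G) :
    𝓒 {p} {z} A ⊆ powersetCard k G := by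
  intro s hs
  obtain ⟨hs, -⟩ | ⟨-, a, ha, rfl⟩ := UV.mem_compression.1 hs
  · exact hA hs
  · have ha' := mem_powersetCard.1 (hA ha)
    refine mem_powersetCard.2 ⟨?_, by rw [UV.card_compress (by simp), ha'.2]⟩
    unfold UV.compress
    grind

namespace IsPairedFamily

theorem compression (hA : IsPairedFamily k G A U V) (hp : p ∈ G) (h : z ∉ U ∪ V ∨ p ∉ U ∪ V) :
    IsPairedFamily k G (𝓒 {p} {z} A) (UV.compress {p} {z} U) (UV.compress {p} {z} V) where
  subset_powersetCard := compression_subset_powersetCard hA.subset_powersetCard hp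
  left_mem := UV.compress_mem_compression hA.left_mem
  right_mem := UV.compress_mem_compression hA.right_mem
  disjoint := disjoint_compress_singleton hA.disjoint h

theorem compression_of_notMem (hA : IsPairedFamily k G A U V) (hp : p ∈ G) (hz : z ∉ U ∪ V) :
    IsPairedFamily k G (𝓒 {p} {z} A) U V := by
  have := hA.compression hp (.inl hz)
  rw [mem_union, not_or] at hz
  rwa [compress_singleton_of_notMem hz.1, compress_singleton_of_notMem hz.2] at this

theorem nonMemberSubfamily (hA : IsPairedFamily k G A U V) (hz : z ∉ U ∪ V) :
    IsPairedFamily k (G.erase z) (A.nonMemberSubfamily z) U V where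
  subset_powersetCard s hs := by
    obtain ⟨hsA, hzs⟩ := mem_nonMemberSubfamily.1 hs
    obtain ⟨hsG, hsk⟩ := mem_powersetCard.1 (hA.subset_powersetCard hsA)
    exact mem_powersetCard.2 ⟨subset_erase.2 ⟨hsG, hzs⟩, hsk⟩
  left_mem := mem_nonMemberSubfamily.2 ⟨hA.left_mem, by grind⟩
  right_mem := mem_nonMemberSubfamily.2 ⟨hA.right_mem, by grind⟩
  disjoint := hA.disjoint

omit [DecidableEq α] in
theorem card_eq (hA : IsPairedFamily k G A U V) : #U = k ∧ #V = k :=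
  ⟨(mem_powersetCard.1 <| hA.subset_powersetCard hA.left_mem).2,
    (mem_powersetCard.1 <| hA.subset_powersetCard hA.right_mem).2⟩

theorem card_union (hA : IsPairedFamily k G A U V) : #(U ∪ V) = 2 * k := by
  rw [card_union_of_disjoint hA.disjoint, hA.card_eq.1, hA.card_eq.2, two_mul]

theorem union_subset (hA : IsPairedFamily k G A U V) : U ∪ V ⊆ G :=
  Finset.union_subset (mem_powersetCard.1 <| hA.subset_powersetCard hA.left_mem).1
    (mem_powersetCard.1 <| hA.subset_powersetCard hA.right_mem).1

end IsPairedFamily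

theorem exists_isPairedFamily_union_eq (hA : IsPairedFamily k G A U V)
    (hB : IsPairedFamily k G B X Y) (h : CrossIntersecting A B) :
    ∃ A' B' X' Y', IsPairedFamily k G A' U V ∧ IsPairedFamily k G B' X' Y' ∧
      CrossIntersecting A' B' ∧ #A' = #A ∧ #B' = #B ∧ U ∪ V = X' ∪ Y' := by
  induction hm : #((X ∪ Y) \ (U ∪ V)) generalizing A B X Y with
  | zero =>
    have hsub : X ∪ Y ⊆ U ∪ V := sdiff_eq_empty_iff_subset.1 (card_eq_zero.1 hm)
    have heq : X ∪ Y = U ∪ V :=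
      eq_of_subset_of_card_le hsub (hA.card_union.trans hB.card_union.symm).le
    exact ⟨A, B, X, Y, hA, hB, h, rfl, rfl, heq.symm⟩
  | succ m ih =>
    obtain ⟨x, hx⟩ : ((X ∪ Y) \ (U ∪ V)).Nonempty := card_pos.1 (by lia)
    obtain ⟨u, hu⟩ : ((U ∪ V) \ (X ∪ Y)).Nonempty := by
      rw [← card_pos, card_sdiff_comm (hA.card_union.trans hB.card_union.symm)]
      lia
    rw [mem_sdiff] at hx hu
    have huG : u ∈ G := hA.union_subset hu.1
    have hunion : UV.compress {u} {x} X ∪ UV.compress {u} {x} Y = insert u ((X ∪ Y).erase x) := by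
      have := disjoint_left.1 hB.disjoint
      by_cases hxX : x ∈ X <;> by_cases hxY : x ∈ Y
      · grind
      · rw [compress_singleton hxX, compress_singleton_of_notMem hxY] <;> grind
      · rw [compress_singleton_of_notMem hxX, compress_singleton hxY] <;> grind
      · grind
    obtain ⟨A', B', X', Y', hA', hB', h', hcA, hcB, hC⟩ :=
      ih (hA.compression_of_notMem huG hx.2) (hB.compression huG (.inr hu.2)) (h.compression u x)
        (by rw [hunion, insert_sdiff_of_mem _ hu.1, erase_sdiff_comm,
          card_erase_of_mem (mem_sdiff.2 hx), hm, Nat.add_sub_cancel])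
    exact ⟨A', B', X', Y', hA', hB', h', by rw [hcA, UV.card_compression],
      by rw [hcB, UV.card_compression], hC⟩

/-- `z` can be replaced by any element of `P` in the members of `A`; equivalently,
`UV.IsCompressed {p} {z} A` holds for every `p ∈ P`. -/
def IsShifted (z : α) (P : Finset α) (A : Finset (Finset α)) : Prop :=
  ∀ ⦃s⦄, z ∉ s → insert z s ∈ A → ∀ p ∈ P, p ∉ s → insert p s ∈ A

theorem IsShifted.compression (hA : IsShifted z P A) (p : α) :
    IsShifted z (insert p P) (𝓒 {p} {z} A) := by
  intro s hz hs q hq hqs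
  obtain rfl | hqz := eq_or_ne q z
  · exact hs
  obtain rfl | hqP := mem_insert.1 hq
  · have := UV.sup_sdiff_mem_of_mem_compression hs (by simp) (by simp [hqz, hqs])
    have hqsA : insert q s ∈ A := by
      convert this using 1
      simp only [sup_eq_union]
      grind
    exact mem_compression_of_notMem hqsA (by grind)
  · have hs' : insert z s ∈ A := UV.mem_of_mem_compression hs (by simp) (by simp)
    exact mem_compression_of_notMem (hA hz hs' q hqP hqs) (by grind)

theorem exists_isPairedFamily_isShifted (hA : IsPairedFamily k G A U V)
    (hB : IsPairedFamily k G B X Y) (h : CrossIntersecting A B) (hzU : z ∉ U ∪ V)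
    (hzX : z ∉ X ∪ Y) (hP : P ⊆ G) :
    ∃ A' B', IsPairedFamily k G A' U V ∧ IsPairedFamily k G B' X Y ∧ CrossIntersecting A' B' ∧
      #A' = #A ∧ #B' = #B ∧ IsShifted z P B' := by
  induction P using Finset.induction_on with
  | empty => exact ⟨A, B, hA, hB, h, rfl, rfl, by simp [IsShifted]⟩
  | insert p P _ ih =>
    obtain ⟨hp, hP⟩ := insert_subset_iff.1 hP
    obtain ⟨A', B', hA', hB', h', hcA, hcB, hsB⟩ := ih hP
    exact ⟨_, _, hA'.compression_of_notMem hp hzU, hB'.compression_of_notMem hp hzX,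
      h'.compression p z, by rw [UV.card_compression, hcA], by rw [UV.card_compression, hcB],
      hsB.compression p⟩

omit [DecidableEq α] in
theorem CrossIntersecting.card_add_card_le_choose (h : CrossIntersecting A B)
    (hA : A ⊆ powersetCard k C) (hB : B ⊆ powersetCard k C) (hC : #C = 2 * k) :
    #A + #B ≤ (2 * k).choose k := by
  classical
  have hmaps : ∀ s ∈ A, C \ s ∈ powersetCard k C \ B := fun s hs => by
    obtain ⟨hsC, hsk⟩ := mem_powersetCard.1 (hA hs)
    refine mem_sdiff.2 ⟨mem_powersetCard.2 ⟨sdiff_subset, ?_⟩, fun hB => h hs hB disjoint_sdiff⟩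
    rw [card_sdiff_of_subset hsC, hC, hsk]
    lia
  have hinj : Set.InjOn (C \ ·) (A : Set (Finset α)) := fun s hs t ht hst => by
    rw [← Finset.sdiff_sdiff_eq_self (mem_powersetCard.1 (hA hs)).1,
      ← Finset.sdiff_sdiff_eq_self (mem_powersetCard.1 (hA ht)).1]
    exact congrArg (C \ ·) hst
  have hle := card_le_card_of_injOn _ hmaps hinj
  rw [card_sdiff_of_subset hB, card_powersetCard, hC] at hle
  have := card_le_card hB
  rw [card_powersetCard, hC] at this
  lia

/-- A family of pairs that are edges of the complete bipartite graph with parts `X` and `Y`. A pair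
is such an edge exactly when it meets both parts. -/
structure IsBipartitePairFamily (E : Finset (Finset α)) (X Y : Finset α) : Prop where
  card_eq : ∀ e ∈ E, #e = 2
  not_disjoint_left : ∀ e ∈ E, ¬ Disjoint e X
  not_disjoint_right : ∀ e ∈ E, ¬ Disjoint e Y
  disjoint : Disjoint X Y

namespace IsBipartitePairFamily

variable {x y : α} {e : Finset α}

omit [DecidableEq α] in
theorem symm (hE : IsBipartitePairFamily E X Y) : IsBipartitePairFamily E Y X :=
  ⟨hE.card_eq, hE.not_disjoint_right, hE.not_disjoint_left, hE.disjoint.symm⟩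

theorem exists_eq_pair (hE : IsBipartitePairFamily E X Y) (he : e ∈ E) :
    ∃ x ∈ X, ∃ y ∈ Y, {x, y} = e := by
  obtain ⟨x, hxe, hx⟩ := not_disjoint_iff.1 (hE.not_disjoint_left e he)
  obtain ⟨y, hye, hy⟩ := not_disjoint_iff.1 (hE.not_disjoint_right e he)
  have hxy : x ≠ y := disjoint_iff_ne.1 hE.disjoint x hx y hy
  refine ⟨x, hx, y, hy, eq_of_subset_of_card_le (by grind) ?_⟩
  rw [hE.card_eq e he, card_pair hxy]

theorem subset_image₂ (hE : IsBipartitePairFamily E X Y) :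
    E ⊆ image₂ (fun x y => {x, y}) X Y := fun _ he => mem_image₂.2 (hE.exists_eq_pair he)

omit [DecidableEq α] in
theorem card_le_mul (hE : IsBipartitePairFamily E X Y) : #E ≤ #X * #Y := by
  classical
  exact (card_le_card hE.subset_image₂).trans (card_image₂_le _ _ _)

theorem pair_mem_of_card_eq (hE : IsBipartitePairFamily E X Y) (hc : #E = #X * #Y)
    (hx : x ∈ X) (hy : y ∈ Y) : {x, y} ∈ E := by
  rw [eq_of_subset_of_card_le hE.subset_image₂ ((card_image₂_le _ _ _).trans hc.ge)]
  exact mem_image₂_of_mem hx hy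

theorem card_filter_mem_le (hE : IsBipartitePairFamily E X Y) (hX : #X = m) (hY : #Y = m) (x : α) :
    #{e ∈ E | x ∈ e} ≤ m := by
  wlog hx : x ∉ X generalizing X Y
  · exact this hE.symm hY hX (disjoint_left.1 hE.disjoint (not_not.1 hx))
  have hpairs : IsBipartitePairFamily {e ∈ E | x ∈ e} {x} X := by
    refine ⟨fun e he => ?_, fun e he => ?_, fun e he => ?_, disjoint_singleton_left.2 hx⟩ <;>
      rw [mem_filter] at he
    · exact hE.card_eq e he.1
    · simpa using he.2
    · exact hE.not_disjoint_left e he.1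
  simpa [hX] using hpairs.card_le_mul

omit [DecidableEq α] in
theorem card_le_two_mul (hF : IsBipartitePairFamily F X Y) (hX : #X = m) (hY : #Y = m)
    (hEF : CrossIntersecting E F) (he : e ∈ E) (hc : #e = 2) : #F ≤ 2 * m := by
  classical
  obtain ⟨x, y, -, rfl⟩ := card_eq_two.1 hc
  have hcover : F ⊆ {f ∈ F | x ∈ f} ∪ {f ∈ F | y ∈ f} := fun f hf => by
    have := not_disjoint_iff.1 (hEF he hf)
    grind
  calc #F ≤ #{f ∈ F | x ∈ f} + #{f ∈ F | y ∈ f} := (card_le_card hcover).trans (card_union_le _ _)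
    _ ≤ 2 * m := by linarith [hF.card_filter_mem_le hX hY x, hF.card_filter_mem_le hX hY y]

omit [DecidableEq α] in
theorem card_le_add_one (hF : IsBipartitePairFamily F X Y) (hX : #X = m) (hY : #Y = m)
    (hm : 3 ≤ m) (hEF : CrossIntersecting E F) (hE : ∀ e ∈ E, #e = 2) (hcard : 1 < #E) :
    #F ≤ m + 1 := by
  classical
  obtain ⟨e, he, e', he', hne⟩ := one_lt_card.1 hcard
  by_cases hd : Disjoint e e'
  · have hF' : IsBipartitePairFamily F e e' :=
      ⟨hF.card_eq, fun f hf => hEF.symm hf he, fun f hf => hEF.symm hf he', hd⟩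
    have := hF'.card_le_mul
    rw [hE e he, hE e' he'] at this
    lia
  · obtain ⟨x, hxe, hxe'⟩ := not_disjoint_iff.1 hd
    have hce : #(e.erase x) = 1 := by rw [card_erase_of_mem hxe, hE e he]
    have hce' : #(e'.erase x) = 1 := by rw [card_erase_of_mem hxe', hE e' he']
    have hd' : Disjoint (e.erase x) (e'.erase x) := by
      obtain ⟨y, hy⟩ := card_eq_one.1 hce
      obtain ⟨y', hy'⟩ := card_eq_one.1 hce'
      rw [hy, hy', disjoint_singleton]
      rintro rfl
      exact hne (by rw [← insert_erase hxe, ← insert_erase hxe', hy, hy'])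
    have hrest : IsBipartitePairFamily {f ∈ F | x ∉ f} (e.erase x) (e'.erase x) := by
      refine ⟨fun f hf => ?_, fun f hf => ?_, fun f hf => ?_, hd'⟩ <;> rw [mem_filter] at hf
      · exact hF.card_eq f hf.1
      · rw [← disjoint_erase_comm, erase_eq_of_notMem hf.2]
        exact hEF.symm hf.1 he
      · rw [← disjoint_erase_comm, erase_eq_of_notMem hf.2]
        exact hEF.symm hf.1 he'
    have h1 := hrest.card_le_mul
    rw [hce, hce'] at h1
    have h2 := card_filter_add_card_filter_not (s := F) (x ∈ ·)
    linarith [hF.card_filter_mem_le hX hY x]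

omit [DecidableEq α] in
theorem card_add_card_le (hE : IsBipartitePairFamily E X Y) (hF : IsBipartitePairFamily F U V)
    (hEF : CrossIntersecting E F) (hX : #X = m) (hY : #Y = m) (hU : #U = m) (hV : #V = m)
    (hm : 3 ≤ m) (hE₀ : E.Nonempty) (hF₀ : F.Nonempty) : #E + #F ≤ 2 * m + 2 := by
  classical
  obtain ⟨e, he⟩ := hE₀
  obtain ⟨f, hf⟩ := hF₀
  obtain hE₁ | hE₁ := le_or_gt #E 1
  · linarith [hF.card_le_two_mul hU hV hEF he (hE.card_eq e he)]
  obtain hF₁ | hF₁ := le_or_gt #F 1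
  · linarith [hE.card_le_two_mul hX hY hEF.symm hf (hF.card_eq f hf)]
  · linarith [hF.card_le_add_one hU hV hm hEF hE.card_eq hE₁,
      hE.card_le_add_one hX hY hm hEF.symm hF.card_eq hF₁]

end IsBipartitePairFamily

theorem IsPairedFamily.isBipartitePairFamily_memberSubfamily (hA : IsPairedFamily 3 G A U V)
    (hB : IsPairedFamily k G B X Y) (h : CrossIntersecting A B) (hz : z ∉ X ∪ Y) :
    IsBipartitePairFamily (A.memberSubfamily z) X Y := by
  rw [mem_union, not_or] at hz
  refine ⟨fun e he => ?_, fun e he => ?_, fun e he => ?_, hB.disjoint⟩ <;>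
    obtain ⟨heA, hze⟩ := mem_memberSubfamily.1 he
  · have := (mem_powersetCard.1 (hA.subset_powersetCard heA)).2
    rw [card_insert_of_notMem hze] at this
    lia
  · simpa [disjoint_insert_left, hz.1] using h heA hB.left_mem
  · simpa [disjoint_insert_left, hz.2] using h heA hB.right_mem

theorem CrossIntersecting.memberSubfamily (h : CrossIntersecting A B) (hsB : IsShifted z P B)
    (hA : ∀ a ∈ A.memberSubfamily z, #a ≤ m) (hB : ∀ b ∈ B.memberSubfamily z, #b ≤ m)
    (hP : 2 * m < #P) (hzP : z ∉ P) :
    CrossIntersecting (A.memberSubfamily z) (B.memberSubfamily z) := by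
  intro a ha b hb hd
  have hlt : #(a ∪ b) < #P := by
    have := card_union_le a b
    have := hA a ha
    have := hB b hb
    lia
  obtain ⟨p, hpP, hp⟩ := exists_mem_notMem_of_card_lt_card hlt
  obtain ⟨haA, -⟩ := mem_memberSubfamily.1 ha
  obtain ⟨hbB, hzb⟩ := mem_memberSubfamily.1 hb
  refine h haA (hsB hzb hbB p hpP (by grind)) ?_
  simp only [disjoint_insert_left, disjoint_insert_right]
  grind

theorem IsPairedFamily.card_eq_two_of_memberSubfamily (hB : IsPairedFamily k G B X Y) (hk : k ≠ 0)
    (h : CrossIntersecting A B) (hA : ∀ x ∈ X, ∀ y ∈ Y, {x, y} ∈ A.memberSubfamily z)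
    (hBz : B.memberSubfamily z = ∅) : #B = 2 := by
  have hsized {b} (hb : b ∈ B) : #b = k := (mem_powersetCard.1 (hB.subset_powersetCard hb)).2
  have hzB {b} (hb : b ∈ B) : z ∉ b := fun hzb => by
    have : b.erase z ∈ B.memberSubfamily z := mem_memberSubfamily.2 (by simp [insert_erase hzb, hb])
    simp [hBz] at this
  have hBXY : B = {X, Y} := by
    ext b
    rw [mem_insert, mem_singleton]
    refine ⟨fun hb => ?_, by rintro (rfl | rfl); exacts [hB.left_mem, hB.right_mem]⟩
    have hsub : X ⊆ b ∨ Y ⊆ b := by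
      by_contra! hnot
      obtain ⟨x, hx, hxb⟩ := not_subset.1 hnot.1
      obtain ⟨y, hy, hyb⟩ := not_subset.1 hnot.2
      refine h (mem_memberSubfamily.1 (hA x hx y hy)).1 hb ?_
      simp [disjoint_insert_left, hzB hb, hxb, hyb]
    exact hsub.imp
      (fun hs => (eq_of_subset_of_card_le hs (by rw [hsized hb, hsized hB.left_mem])).symm)
      (fun hs => (eq_of_subset_of_card_le hs (by rw [hsized hb, hsized hB.right_mem])).symm)
  have hXY : X ≠ Y := fun hXY => by
    have hX : X = ∅ := (disjoint_self_iff_empty X).1 (hXY ▸ hB.disjoint)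
    exact hk (by rw [← hsized hB.left_mem, hX, card_empty])
  rw [hBXY, card_pair hXY]

theorem CrossIntersecting.card_memberSubfamily_add_card_memberSubfamily_le
    (h : CrossIntersecting A B) (hA : IsPairedFamily 3 G A U V) (hB : IsPairedFamily 3 G B X Y)
    (hUX : U ∪ V = X ∪ Y) (hz : z ∉ X ∪ Y) (hsB : IsShifted z (X ∪ Y) B) :
    #(A.memberSubfamily z) + #(B.memberSubfamily z) ≤ 9 ∧
      (#(A.memberSubfamily z) + #(B.memberSubfamily z) = 9 → #A = 2 ∨ #B = 2) := by
  have hE := hA.isBipartitePairFamily_memberSubfamily hB h hz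
  have hF := hB.isBipartitePairFamily_memberSubfamily hA h.symm (hUX ▸ hz)
  have hEF : CrossIntersecting (A.memberSubfamily z) (B.memberSubfamily z) :=
    h.memberSubfamily hsB (fun e he => (hE.card_eq e he).le) (fun f hf => (hF.card_eq f hf).le)
      (by rw [hB.card_union]; lia) hz
  obtain ⟨hU, hV⟩ := hA.card_eq
  obtain ⟨hX, hY⟩ := hB.card_eq
  have hE₉ := hE.card_le_mul
  have hF₉ := hF.card_le_mul
  rw [hX, hY] at hE₉
  rw [hU, hV] at hF₉
  obtain hE₀ | hE₀ := (A.memberSubfamily z).eq_empty_or_nonempty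
  · rw [hE₀, card_empty, zero_add]
    refine ⟨hF₉, fun hF₁ => .inl ?_⟩
    exact hA.card_eq_two_of_memberSubfamily three_ne_zero h.symm
      (fun u hu v hv => hF.pair_mem_of_card_eq (by rw [hF₁, hU, hV]) hu hv) hE₀
  obtain hF₀ | hF₀ := (B.memberSubfamily z).eq_empty_or_nonempty
  · rw [hF₀, card_empty, add_zero]
    refine ⟨hE₉, fun hE₁ => .inr ?_⟩
    exact hB.card_eq_two_of_memberSubfamily three_ne_zero h
      (fun x hx y hy => hE.pair_mem_of_card_eq (by rw [hE₁, hX, hY]) hx hy) hF₀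
  · have := hE.card_add_card_le hF hEF hX hY hU hV le_rfl hE₀ hF₀
    lia

theorem CrossIntersecting.card_add_card_le_of_union_eq (h : CrossIntersecting A B)
    (hA : IsPairedFamily 3 G A U V) (hB : IsPairedFamily 3 G B X Y) (hUX : U ∪ V = X ∪ Y) :
    #A + #B + 34 ≤ 9 * #G ∧ (7 ≤ #G → 9 * #G = #A + #B + 34 → #A = 2 ∨ #B = 2) := by
  induction hm : #(G \ (X ∪ Y)) generalizing A B G with
  | zero =>
    have hG : G = X ∪ Y :=
      (sdiff_eq_empty_iff_subset.1 (card_eq_zero.1 hm)).antisymm hB.union_subset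
    have hcG : #G = 2 * 3 := hG ▸ hB.card_union
    have hle : #A + #B ≤ (2 * 3).choose 3 :=
      h.card_add_card_le_choose hA.subset_powersetCard hB.subset_powersetCard hcG
    have hchoose : (2 * 3).choose 3 = 20 := rfl
    lia
  | succ m ih =>
    obtain ⟨z, hz⟩ : (G \ (X ∪ Y)).Nonempty := card_pos.1 (by lia)
    obtain ⟨hzG, hzX⟩ := mem_sdiff.1 hz
    have hzU : z ∉ U ∪ V := hUX ▸ hzX
    obtain ⟨A', B', hA', hB', h', hcA, hcB, hsB⟩ :=
      exists_isPairedFamily_isShifted hA hB h hzU hzX hB.union_subset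
    have hlink := h'.card_memberSubfamily_add_card_memberSubfamily_le hA' hB' hUX hzX hsB
    have h₀ : CrossIntersecting (A'.nonMemberSubfamily z) (B'.nonMemberSubfamily z) :=
      h'.mono (filter_subset _ _) (filter_subset _ _)
    have hbase := (ih h₀ (hA'.nonMemberSubfamily hzU) (hB'.nonMemberSubfamily hzX)
      (by rw [erase_sdiff_comm, card_erase_of_mem hz, hm, Nat.add_sub_cancel])).1
    have hG := card_erase_add_one hzG
    have hcA' := card_memberSubfamily_add_card_nonMemberSubfamily z A'
    have hcB' := card_memberSubfamily_add_card_nonMemberSubfamily z B'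
    lia

omit [DecidableEq α] in
theorem CrossIntersecting.card_add_card_le (h : CrossIntersecting A B)
    (hA : IsPairedFamily 3 G A U V) (hB : IsPairedFamily 3 G B X Y) :
    #A + #B + 34 ≤ 9 * #G ∧ (7 ≤ #G → 9 * #G = #A + #B + 34 → #A = 2 ∨ #B = 2) := by
  classical
  obtain ⟨A', B', X', Y', hA', hB', h', hcA, hcB, hUX⟩ := exists_isPairedFamily_union_eq hA hB h
  simpa only [hcA, hcB] using h'.card_add_card_le_of_union_eq hA' hB' hUX

end CrossIntersectingFamilies

section VertexSeparations

open Finset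

variable {V : Type*} {G : SimpleGraph V} {u v w : V} {A B S : Finset V}

theorem not_preconnected_of_eq_pairNeighborSet (hS : (S : Set V) = G.pairNeighborSet u v)
    (hw : w ∉ S) (hwu : w ≠ u) (hwv : w ≠ v) : ¬ (G.induce (S : Set V)ᶜ).Preconnected := by
  intro hconn
  have hu : u ∉ S := by simp [← mem_coe, hS, SimpleGraph.pairNeighborSet]
  obtain ⟨W⟩ := hconn ⟨u, hu⟩ ⟨w, hw⟩
  obtain ⟨d, -, hd, hd'⟩ := W.exists_boundary_dart {a | a.1 = u ∨ a.1 = v} (.inl rfl)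
    (not_or.2 ⟨hwu, hwv⟩)
  have hadj : G.Adj d.fst.1 d.snd.1 := d.adj
  have hd : d.fst.1 = u ∨ d.fst.1 = v := hd
  have hmem : d.snd.1 ∈ G.pairNeighborSet u v :=
    ⟨hd.imp (fun h => by rwa [h] at hadj) (fun h => by rwa [h] at hadj), hd'⟩
  rw [← hS] at hmem
  exact d.snd.2 hmem

/-- Deleting `S` from `G` leaves two parts `A` and `B` with no edges between them. -/
structure IsVertexSeparation (G : SimpleGraph V) (S A B : Finset V) : Prop where
  disjoint : Disjoint A B
  mem_or_mem_iff : ∀ v, v ∈ A ∨ v ∈ B ↔ v ∉ S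
  not_adj : ∀ a ∈ A, ∀ b ∈ B, ¬ G.Adj a b

namespace IsVertexSeparation

theorem symm (h : IsVertexSeparation G S A B) : IsVertexSeparation G S B A :=
  ⟨h.disjoint.symm, fun v => or_comm.trans (h.mem_or_mem_iff v),
    fun b hb a ha hba => h.not_adj a ha b hb hba.symm⟩

theorem card_add_card [Fintype V] (h : IsVertexSeparation G S A B) :
    #S + (#A + #B) = Fintype.card V := by
  classical
  have hc : A ∪ B = Sᶜ := by
    ext v
    rw [mem_union, mem_compl, h.mem_or_mem_iff]
  rw [← card_union_of_disjoint h.disjoint, hc, card_add_card_compl]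

theorem pairNeighborSet_subset (h : IsVertexSeparation G S A B) (hu : u ∈ A) (hv : v ∈ A)
    (huv : u ≠ v) (hA : #A = 2) : G.pairNeighborSet u v ⊆ S := by
  classical
  have hA' : {u, v} = A :=
    eq_of_subset_of_card_le (by simp [insert_subset_iff, hu, hv]) (by rw [hA, card_pair huv])
  rintro w ⟨hadj, hw⟩
  by_contra hwS
  obtain hwA | hwB := (h.mem_or_mem_iff w).2 hwS
  · exact hw (by simpa [← hA'] using hwA)
  · exact hadj.elim (h.not_adj u hu w hwB) (h.not_adj v hv w hwB)

end IsVertexSeparation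

theorem exists_isVertexSeparation [Finite V] (hS : ¬ (G.induce (S : Set V)ᶜ).Preconnected)
    (hiso : ∀ v, ∃ w, (G.induce (S : Set V)ᶜ).Adj v w) :
    ∃ A B, IsVertexSeparation G S A B ∧ (∃ u ∈ A, ∃ v ∈ A, G.Adj u v) ∧
      ∃ x ∈ B, ∃ y ∈ B, G.Adj x y := by
  classical
  have := Fintype.ofFinite V
  simp only [SimpleGraph.Preconnected, not_forall] at hS
  obtain ⟨u, x, hux⟩ := hS
  obtain ⟨v, huv⟩ := hiso u
  obtain ⟨y, hxy⟩ := hiso x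
  let R (a : V) : Prop := ∃ h : a ∉ S, (G.induce (S : Set V)ᶜ).Reachable u ⟨a, h⟩
  have hR {a : ((S : Set V)ᶜ : Set V)} : R a ↔ (G.induce (S : Set V)ᶜ).Reachable u a :=
    ⟨fun ⟨_, h⟩ => h, fun h => ⟨a.2, h⟩⟩
  have hmem {a : ((S : Set V)ᶜ : Set V)} : a.1 ∉ S := a.2
  have hRadj {a b : V} (ha : R a) (hb : b ∉ S) (hab : G.Adj a b) : R b := by
    obtain ⟨haS, hua⟩ := ha
    have hab' : (G.induce (S : Set V)ᶜ).Adj ⟨a, haS⟩ ⟨b, hb⟩ := hab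
    exact ⟨hb, hua.trans hab'.reachable⟩
  refine ⟨({a | a ∉ S ∧ R a} : Finset V), ({a | a ∉ S ∧ ¬ R a} : Finset V), ⟨?_, ?_, ?_⟩, ?_, ?_⟩
  · exact disjoint_filter.2 fun _ _ h h' => h'.2 h.2
  · intro a
    by_cases ha : R a <;> simp [ha]
  · intro a ha b hb hab
    rw [mem_filter] at ha hb
    exact hb.2.2 (hRadj ha.2.2 hb.2.1 hab)
  · exact ⟨u, by simp [hmem, hR], v, by simp [hmem, hR, huv.reachable], huv⟩
  · have hy : ¬ (G.induce (S : Set V)ᶜ).Reachable u y := fun h => hux (h.trans hxy.symm.reachable)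
    exact ⟨x, by simp [hmem, hR, hux], y, by simp [hmem, hR, hy], hxy⟩

end VertexSeparations

/-- The vertices of `KG(n, k)`. -/
abbrev KneserVertex (n k : ℕ) : Type := {s : Finset (Fin n) // s.card = k}

section KneserGraph

open Finset

variable {n k : ℕ} {u v a : KneserVertex n k} {p q : Fin n} {s : Finset (Fin n)}

theorem kneserGraph_adj (hk : k ≠ 0) : (kneserGraph n k).Adj u v ↔ Disjoint u.1 v.1 := by
  refine ⟨And.right, fun h => ⟨?_, h⟩⟩
  rintro rfl
  have hu : u.1 = ∅ := disjoint_self_iff_empty _ |>.1 h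
  exact hk (by rw [← u.2, hu, card_empty])

theorem exists_kneserGraph_adj (hk : k ≠ 0) (hn : 2 * k ≤ n) (u : KneserVertex n k) :
    ∃ v, (kneserGraph n k).Adj u v := by
  obtain ⟨v, hv, hc⟩ := exists_subset_card_eq (s := u.1ᶜ) (n := k)
    (by rw [card_compl, Fintype.card_fin, u.2]; lia)
  exact ⟨⟨v, hc⟩, (kneserGraph_adj hk).2 (subset_compl_iff_disjoint_left.1 hv)⟩

theorem nonempty_kneserVertex (hn : k ≤ n) : Nonempty (KneserVertex n k) := by
  obtain ⟨u, -, hu⟩ := exists_subset_card_eq (s := (univ : Finset (Fin n))) (n := k) (by simpa)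
  exact ⟨⟨u, hu⟩⟩

theorem card_filter_disjoint (s : Finset (Fin n)) :
    #{a : KneserVertex n k | Disjoint s a.1} = (n - #s).choose k := by
  have h : ({a | Disjoint s a.1} : Finset (KneserVertex n k)).map (.subtype _) =
      powersetCard k sᶜ := by
    ext t
    simp [mem_powersetCard, subset_compl_iff_disjoint_left]
  rw [← card_map, h, card_powersetCard, card_compl, Fintype.card_fin]

theorem card_pairNeighborSet (hk : k ≠ 0) (huv : (kneserGraph n k).Adj u v) :
    ((kneserGraph n k).pairNeighborSet u v).ncard + (n - 2 * k).choose k + 2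
      = 2 * (n - k).choose k := by
  let N (s : Finset (Fin n)) : Finset (KneserVertex n k) := {a | Disjoint s a.1}
  have hN (s : Finset (Fin n)) : #(N s) = (n - #s).choose k := card_filter_disjoint s
  have hd : Disjoint u.1 v.1 := (kneserGraph_adj hk).1 huv
  have hset : (kneserGraph n k).pairNeighborSet u v = ↑((N u.1 ∪ N v.1) \ {u, v}) := by
    ext a
    simp [SimpleGraph.pairNeighborSet, kneserGraph_adj hk, N]
  have hsub : {u, v} ⊆ N u.1 ∪ N v.1 := by simp [insert_subset_iff, hd, hd.symm, N]
  have hinter : N u.1 ∩ N v.1 = N (u.1 ∪ v.1) := by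
    ext a
    simp [N, disjoint_union_left]
  have hdiff := card_sdiff_add_card_eq_card hsub
  have hunion := card_union_add_card_inter (N u.1) (N v.1)
  rw [hinter, hN, hN, hN, card_union_of_disjoint hd, u.2, v.2, ← two_mul, ← two_mul] at hunion
  rw [card_pair huv.ne] at hdiff
  rw [hset, Set.ncard_coe_finset]
  lia

theorem exists_notMem_pairNeighborSet (hk : 2 ≤ k) (hp : p ∈ u.1) (hq : q ∈ v.1) (hps : p ∈ s)
    (hqs : q ∈ s) (hs : k ≤ #s) :
    ∃ w : KneserVertex n k, w.1 ⊆ s ∧ p ∈ w.1 ∧ q ∈ w.1 ∧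
      w ∉ (kneserGraph n k).pairNeighborSet u v := by
  obtain ⟨w, hpqw, hws, hwk⟩ := exists_subsuperset_card_eq (s := {p, q}) (t := s) (n := k)
    (by simp [insert_subset_iff, hps, hqs]) (card_le_two.trans hk) hs
  obtain ⟨hpw, hqw⟩ : p ∈ w ∧ q ∈ w := by simpa [insert_subset_iff] using hpqw
  refine ⟨⟨w, hwk⟩, hws, hpw, hqw, ?_⟩
  rintro ⟨hadj | hadj, -⟩
  · exact disjoint_left.1 hadj.2 hp hpw
  · exact disjoint_left.1 hadj.2 hq hqw

theorem exists_mem_notMem_of_ne (h : u ≠ v) : ∃ p ∈ u.1, p ∉ v.1 := by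
  by_contra! hsub
  exact h (Subtype.ext (eq_of_subset_of_card_le hsub (by rw [u.2, v.2])))

theorem exists_kneserGraph_adj_notMem_pairNeighborSet (hk : 2 ≤ k) (hn : 2 * k ≤ n)
    (huv : (kneserGraph n k).Adj u v) (a : KneserVertex n k) :
    ∃ w, (kneserGraph n k).Adj a w ∧ w ∉ (kneserGraph n k).pairNeighborSet u v := by
  obtain rfl | hau := eq_or_ne a u
  · exact ⟨v, huv, fun h => h.2 (.inr rfl)⟩
  obtain rfl | hav := eq_or_ne a v
  · exact ⟨u, huv.symm, fun h => h.2 (.inl rfl)⟩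
  obtain ⟨p, hpu, hpa⟩ := exists_mem_notMem_of_ne hau.symm
  obtain ⟨q, hqv, hqa⟩ := exists_mem_notMem_of_ne hav.symm
  obtain ⟨w, hwa, -, -, hw⟩ := exists_notMem_pairNeighborSet (s := a.1ᶜ) hk hpu hqv
    (mem_compl.2 hpa) (mem_compl.2 hqa) (by rw [card_compl, Fintype.card_fin, a.2]; lia)
  exact ⟨w, (kneserGraph_adj (by lia)).2 (subset_compl_iff_disjoint_left.1 hwa), hw⟩

theorem isSuperVertexCut_of_eq_pairNeighborSet (hk : 2 ≤ k) (hn : 2 * k ≤ n)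
    (hconn : (kneserGraph n k).Connected) (huv : (kneserGraph n k).Adj u v)
    {S : Finset (KneserVertex n k)} (hS : (S : Set _) = (kneserGraph n k).pairNeighborSet u v) :
    (kneserGraph n k).IsSuperVertexCut S := by
  have hmem {a} : a ∉ (kneserGraph n k).pairNeighborSet u v → a ∉ S := fun ha h => ha (hS ▸ h)
  refine ⟨⟨hconn, ?_⟩, fun a => ?_⟩
  · obtain ⟨p, hp⟩ : u.1.Nonempty := card_pos.1 (by rw [u.2]; lia)
    obtain ⟨q, hq⟩ : v.1.Nonempty := card_pos.1 (by rw [v.2]; lia)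
    obtain ⟨w, -, hpw, hqw, hw⟩ := exists_notMem_pairNeighborSet (s := univ) hk hp hq (mem_univ p)
      (mem_univ q) (by rw [card_univ, Fintype.card_fin]; lia)
    have hwu : w ≠ u := by
      rintro rfl
      exact disjoint_left.1 huv.2 hqw hq
    have hwv : w ≠ v := by
      rintro rfl
      exact disjoint_left.1 huv.2 hp hpw
    exact not_preconnected_of_eq_pairNeighborSet hS (hmem hw) hwu hwv
  · obtain ⟨w, haw, hw⟩ := exists_kneserGraph_adj_notMem_pairNeighborSet hk hn huv a.1
    exact ⟨⟨w, hmem hw⟩, haw⟩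

theorem choose_three_add_choose_three (hn : 7 ≤ n) :
    n.choose 3 + (n - 6).choose 3 + 36 = 2 * (n - 3).choose 3 + 9 * n := by
  obtain ⟨m, rfl⟩ := Nat.exists_eq_add_of_le' hn
  rw [show m + 7 - 6 = m + 1 by lia, show m + 7 - 3 = m + 4 by lia]
  simp only [Nat.choose_succ_succ', Nat.choose_zero_right, Nat.choose_one_right, Nat.reduceAdd]
  lia

theorem nine_mul_lt_choose_three_add (hn : 7 ≤ n) : 9 * n < n.choose 3 + 34 := by
  obtain ⟨m, rfl⟩ := Nat.exists_eq_add_of_le' hn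
  simp only [Nat.choose_succ_succ', Nat.choose_zero_right, Nat.choose_one_right, Nat.reduceAdd]
  lia

theorem isPairedFamily_map_subtype {A : Finset (KneserVertex n k)} (hu : u ∈ A) (hv : v ∈ A)
    (huv : (kneserGraph n k).Adj u v) :
    IsPairedFamily k univ (A.map (.subtype _)) u.1 v.1 where
  subset_powersetCard := by
    intro s hs
    obtain ⟨a, -, rfl⟩ := mem_map.1 hs
    exact mem_powersetCard.2 ⟨subset_univ _, a.2⟩
  left_mem := mem_map_of_mem _ hu
  right_mem := mem_map_of_mem _ hv
  disjoint := huv.2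

theorem IsVertexSeparation.crossIntersecting_map_subtype (hk : k ≠ 0)
    {S A B : Finset (KneserVertex n k)} (h : IsVertexSeparation (kneserGraph n k) S A B) :
    CrossIntersecting (A.map (.subtype _)) (B.map (.subtype _)) := by
  intro s hs t ht
  obtain ⟨a, ha, rfl⟩ := mem_map.1 hs
  obtain ⟨b, hb, rfl⟩ := mem_map.1 ht
  exact fun hd => h.not_adj a ha b hb ((kneserGraph_adj hk).2 hd)

theorem choose_three_add_le_card_of_not_preconnected (hn : 7 ≤ n) {S : Finset (KneserVertex n 3)}
    (hS : ¬ ((kneserGraph n 3).induce (S : Set (KneserVertex n 3))ᶜ).Preconnected)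
    (hiso : ∀ v, ∃ w, ((kneserGraph n 3).induce (S : Set (KneserVertex n 3))ᶜ).Adj v w) :
    n.choose 3 + 34 ≤ #S + 9 * n ∧ (n.choose 3 + 34 = #S + 9 * n →
      ∃ u v, (kneserGraph n 3).Adj u v ∧ (kneserGraph n 3).pairNeighborSet u v ⊆ S) := by
  obtain ⟨A, B, h, ⟨u, hu, v, hv, huv⟩, x, hx, y, hy, hxy⟩ := exists_isVertexSeparation hS hiso
  obtain ⟨hle, heq⟩ := (h.crossIntersecting_map_subtype three_ne_zero).card_add_card_le
    (isPairedFamily_map_subtype hu hv huv) (isPairedFamily_map_subtype hx hy hxy)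
  rw [card_map, card_map, card_univ, Fintype.card_fin] at hle heq
  have hcard : #S + (#A + #B) = n.choose 3 := by simpa using h.card_add_card
  refine ⟨by lia, fun hS => ?_⟩
  obtain hA | hB := heq hn (by lia)
  · exact ⟨u, v, huv, h.pairNeighborSet_subset hu hv huv.ne hA⟩
  · exact ⟨x, y, hxy, h.symm.pairNeighborSet_subset hx hy hxy.ne hB⟩

theorem kneserGraph_three_connected (hn : 7 ≤ n) : (kneserGraph n 3).Connected := by
  refine (SimpleGraph.connected_iff _).2 ⟨?_, nonempty_kneserVertex (by lia)⟩
  by_contra hconn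
  have hle := (choose_three_add_le_card_of_not_preconnected hn (S := ∅) (fun h => ?_)
    fun v => ?_).1
  · have := nine_mul_lt_choose_three_add hn
    rw [card_empty] at hle
    lia
  · exact hconn fun a b =>
      (h ⟨a, by simp⟩ ⟨b, by simp⟩).map (SimpleGraph.Embedding.induce _).toHom
  · obtain ⟨w, hw⟩ := exists_kneserGraph_adj three_ne_zero (by lia) v.1
    exact ⟨⟨w, by simp⟩, hw⟩

theorem card_add_nine_mul_of_eq_pairNeighborSet (hn : 7 ≤ n) {u v : KneserVertex n 3}
    (huv : (kneserGraph n 3).Adj u v) {S : Finset (KneserVertex n 3)}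
    (hS : (S : Set _) = (kneserGraph n 3).pairNeighborSet u v) :
    #S + 9 * n = n.choose 3 + 34 := by
  have hcard := card_pairNeighborSet three_ne_zero huv
  rw [← hS, Set.ncard_coe_finset] at hcard
  have := choose_three_add_choose_three hn
  lia

theorem exists_isSuperVertexCut_card (hn : 7 ≤ n) :
    ∃ S, (kneserGraph n 3).IsSuperVertexCut S ∧ #S + 9 * n = n.choose 3 + 34 := by
  obtain ⟨u⟩ := nonempty_kneserVertex (n := n) (k := 3) (by lia)
  obtain ⟨v, huv⟩ := exists_kneserGraph_adj three_ne_zero (by lia) u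
  obtain ⟨S, hS⟩ := ((kneserGraph n 3).pairNeighborSet u v).toFinite.exists_finset_coe
  exact ⟨S, isSuperVertexCut_of_eq_pairNeighborSet (by lia) (by lia)
    (kneserGraph_three_connected hn) huv hS, card_add_nine_mul_of_eq_pairNeighborSet hn huv hS⟩

theorem superConnectivity_kneserGraph_three (hn : 7 ≤ n) :
    (kneserGraph n 3).superConnectivity + 9 * n = n.choose 3 + 34 := by
  obtain ⟨S, hS, hcard⟩ := exists_isSuperVertexCut_card hn
  have hmin : (kneserGraph n 3).superConnectivity = #S := by
    refine le_antisymm (Nat.sInf_le ⟨S, hS, rfl⟩) (le_csInf ⟨_, S, hS, rfl⟩ ?_)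
    rintro _ ⟨T, hT, rfl⟩
    have := (choose_three_add_le_card_of_not_preconnected hn hT.1.2 hT.2).1
    lia
  rw [hmin, hcard]

end KneserGraph

/-- For `n ≥ 7`: super vertex cuts of `KG(n, 3)` exist, their minimum size is as stated, and the
minimum ones are exactly the neighbourhoods of edges. -/
theorem theorem2p1 (n : ℕ) (hn : 7 ≤ n) :
    (∃ S, (kneserGraph n 3).IsSuperVertexCut S) ∧
    (n ≤ 8 → ((kneserGraph n 3).superConnectivity : ℤ) =
      2 * (((n - 3).choose 3 : ℤ) - 1)) ∧
    (9 ≤ n → ((kneserGraph n 3).superConnectivity : ℤ) =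
      2 * (((n - 3).choose 3 : ℤ) - 1) - ((n - 6).choose 3 : ℤ)) ∧
    (∀ S, ((kneserGraph n 3).IsSuperVertexCut S ∧
        S.card = (kneserGraph n 3).superConnectivity) ↔
      ∃ u v, (kneserGraph n 3).Adj u v ∧
        (S : Set {s : Finset (Fin n) // s.card = 3}) = (kneserGraph n 3).pairNeighborSet u v) := by
  have hκ := superConnectivity_kneserGraph_three hn
  have hchoose := choose_three_add_choose_three hn
  obtain ⟨S₀, hS₀, -⟩ := exists_isSuperVertexCut_card hn
  refine ⟨⟨S₀, hS₀⟩, fun hn₈ => ?_, fun _ => by lia, fun S => ⟨?_, ?_⟩⟩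
  · have h₀ : (n - 6).choose 3 = 0 := Nat.choose_eq_zero_of_lt (by lia)
    lia
  · rintro ⟨hS, hcard⟩
    obtain ⟨u, v, huv, hsub⟩ :=
      (choose_three_add_le_card_of_not_preconnected hn hS.1.2 hS.2).2 (by lia)
    obtain ⟨T, hT⟩ := ((kneserGraph n 3).pairNeighborSet u v).toFinite.exists_finset_coe
    have hcardT := card_add_nine_mul_of_eq_pairNeighborSet hn huv hT
    rw [← hT, Finset.coe_subset] at hsub
    exact ⟨u, v, huv, by rw [← hT, Finset.eq_of_subset_of_card_le hsub (by lia)]⟩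
  · rintro ⟨u, v, huv, hS⟩
    have hcard := card_add_nine_mul_of_eq_pairNeighborSet hn huv hS
    exact ⟨isSuperVertexCut_of_eq_pairNeighborSet (by lia) (by lia)
      (kneserGraph_three_connected hn) huv hS, by lia⟩
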